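/- Let $K$ be a commutative ring, $R$ a unital associative $K$-algebra and $G$ a finite group such that $|G|$ is invertible in $R$. Let $\alpha=(\{D_g\}_{g\in G},\{\alpha_g\}_{g\in G},\{w_{g,h}\}_{g,h\in G})$ be a unital twisted partial action of $G$ on $R$: each $D_g$ is a two-sided ideal of $R$ generated by a central idempotent $1_g$, each $\alpha_g:D_{g^{-1}}\to D_g$ is an isomorphism of rings, each $w_{g,h}$ is an invertible element of the unital ring $D_gD_{gh}$ (with identity $1_g1_{gh}$), and for all $g,h,t\in G$, writing $e$ for the identity of $G$: (i) $D_e=R$ and $\alpha_e=\mathrm{id}_R$; (ii) $\alpha_g(D_{g^{-1}}D_h)=D_gD_{gh}$; (iii) $\alpha_g(\alpha_h(a))=w_{g,h}\,\alpha_{gh}(a)\,w_{g,h}^{-1}$ for all $a\in D_{h^{-1}}D_{h^{-1}g^{-1}}$; (iv) $w_{g,e}=w_{e,g}=1_g$; (v) $\alpha_g(a\,w_{h,t})\,w_{g,ht}=\alpha_g(a)\,w_{g,h}\,w_{gh,t}$ for all $a\in D_{g^{-1}}D_hD_{ht}$. Let $R*_{\alpha,w}G=\bigoplus_{g\in G}D_g\delta_g$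 be the partial crossed product, that is, the ring with the usual addition and with multiplication determined by $(a\delta_g)(b\delta_h)=\alpha_g(\alpha_g^{-1}(a)\,b)\,w_{g,h}\,\delta_{gh}$ for $a\in D_g$, $b\in D_h$. Let $\operatorname{lgdim}S$ denote the left global dimension of a ring $S$, the supremum of the projective dimensions of the left $S$-modules. Then $$\operatorname{lgdim}R=\operatorname{lgdim}(R*_{\alpha,w}G).$$ Moreover, $R$ is left hereditary (every left $R$-module has projective dimension at most $1$) if and only if $R*_{\alpha,w}G$ is left hereditary, and $R$ is semisimple artinian if and only if $R*_{\alpha,w}G$ is semisimple artinian. -/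

import Mathlib

open CategoryTheory

universe w u v

/-- A unital twisted partial action of a group `G` on a (unital, associative) ring `R`:
two-sided ideals `D g` generated by central idempotents `e g` (usually written `1_g`), ring
isomorphisms `α g : D g⁻¹ → D g`, and invertible elements `tw g h` (usually written `w_{g,h}`)
of the unital ring `D g * D (g * h)`, subject to the postulates below.
Since the ideals are generated by central idempotents, the product of two (or three) of them
is their intersection, and `e g * e (g * h)` is the identity element of `D g * D (g * h)`. -/
structure UnitalTwistedPartialAction (G : Type v) (R : Type u) [Group G] [Ring R] where
  /-- the ideals `D_g` -/
  D : G → TwoSidedIdeal R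
  /-- the central idempotents `1_g` -/
  e : G → R
  e_idem : ∀ g, IsIdempotentElem (e g)
  e_central : ∀ g, e g ∈ Subring.center R
  D_eq_span : ∀ g, D g = TwoSidedIdeal.span {e g}
  /-- the ring isomorphisms `α_g` -/
  α : ∀ g, D g⁻¹ ≃+* D g
  /-- the elements `w_{g,h}` -/
  tw : G → G → R
  /-- the inverse of `w_{g,h}` in the unital ring `D_g D_{gh}` -/
  twInv : G → G → R
  tw_mem : ∀ g h, tw g h ∈ D g ∧ tw g h ∈ D (g * h)
  twInv_mem : ∀ g h, twInv g h ∈ D g ∧ twInv g h ∈ D (g * h)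
  tw_mul_twInv : ∀ g h, tw g h * twInv g h = e g * e (g * h)
  twInv_mul_tw : ∀ g h, twInv g h * tw g h = e g * e (g * h)
  /-- `D_1 = R` -/
  D_one : D 1 = ⊤
  /-- `α_1` is the identity map of `R` -/
  α_one : ∀ x : D 1⁻¹, (α 1 x : R) = x
  /-- `α_g (D_{g⁻¹} D_h) = D_g D_{gh}` -/
  image_α : ∀ g h,
    (fun x : D g⁻¹ => (α g x : R)) '' {x | (x : R) ∈ D h} = (D g : Set R) ∩ D (g * h)
  /-- `α_g (α_h a) = w_{g,h} α_{gh}(a) w_{g,h}⁻¹` for `a ∈ D_{h⁻¹} D_{h⁻¹g⁻¹}`; for such `a`,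
  `α_h a` does lie in `D_{g⁻¹}`, by the preceding postulate. -/
  α_α : ∀ g h (a : R) (h₁ : a ∈ D h⁻¹) (h₂ : a ∈ D (g * h)⁻¹)
    (h₃ : (α h ⟨a, h₁⟩ : R) ∈ D g⁻¹),
    (α g ⟨α h ⟨a, h₁⟩, h₃⟩ : R) = tw g h * α (g * h) ⟨a, h₂⟩ * twInv g h
  /-- `w_{g,1} = 1_g` -/
  tw_one_right : ∀ g, tw g 1 = e g
  /-- `w_{1,g} = 1_g` -/
  tw_one_left : ∀ g, tw 1 g = e g
  /-- `α_g(a w_{h,t}) w_{g,ht} = α_g(a) w_{g,h} w_{gh,t}` for `a ∈ D_{g⁻¹} D_h D_{ht}` -/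
  cocycle : ∀ g h t (a : R) (ha : a ∈ D g⁻¹), a ∈ D h → a ∈ D (h * t) →
    (α g ⟨a * tw h t, (D g⁻¹).mul_mem_right _ _ ha⟩ : R) * tw g (h * t) =
      α g ⟨a, ha⟩ * tw g h * tw (g * h) t

namespace UnitalTwistedPartialAction

variable {G : Type v} {R : Type u} [Group G] [Ring R] (A : UnitalTwistedPartialAction G R)

lemma e_comm (g : G) (r : R) : A.e g * r = r * A.e g :=
  (Subring.mem_center_iff.mp (A.e_central g) r).symm

lemma e_mul_mul (g : G) (r s : R) : A.e g * r * s = r * (A.e g * s) := by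
  rw [A.e_comm, mul_assoc]

lemma e_mem (g : G) : A.e g ∈ A.D g := by
  rw [A.D_eq_span]; exact TwoSidedIdeal.subset_span rfl

lemma mem_D_iff (g : G) (r : R) : r ∈ A.D g ↔ A.e g * r = r := by
  constructor
  · intro h
    rw [A.D_eq_span] at h
    induction h using TwoSidedIdeal.span_induction with
    | mem x h => rw [Set.mem_singleton_iff] at h; subst h; exact A.e_idem g
    | zero => simp
    | add x y _ _ hx hy => rw [mul_add, hx, hy]
    | neg x _ hx => rw [mul_neg, hx]
    | left_absorb a x _ hx => rw [← mul_assoc, A.e_comm, mul_assoc, hx]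
    | right_absorb b x _ hx => rw [← mul_assoc, hx]
  · intro h
    rw [← h]
    exact (A.D g).mul_mem_right _ _ (A.e_mem g)

/-- The extension `r ↦ α_g (1_{g⁻¹} r)` of `α_g` to all of `R`, an auxiliary map used in the
verification of the ring axioms. -/
def ext (g : G) (r : R) : R :=
  A.α g ⟨A.e g⁻¹ * r, (A.D g⁻¹).mul_mem_right _ _ (A.e_mem g⁻¹)⟩

lemma α_eq_ext (g : G) (x : A.D g⁻¹) : (A.α g x : R) = A.ext g x := by
  have : x = ⟨A.e g⁻¹ * x, (A.D g⁻¹).mul_mem_right _ _ (A.e_mem g⁻¹)⟩ :=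
    Subtype.ext ((A.mem_D_iff _ _).mp x.2).symm
  exact congrArg (fun y => (A.α g y : R)) this

lemma ext_add (g : G) (r s : R) : A.ext g (r + s) = A.ext g r + A.ext g s := by
  unfold ext
  rw [← AddMemClass.coe_add, ← map_add]
  congr 2
  exact Subtype.ext (mul_add _ _ _)

lemma ext_mul (g : G) (r s : R) : A.ext g (r * s) = A.ext g r * A.ext g s := by
  unfold ext
  rw [← MulMemClass.coe_mul, ← map_mul]
  congr 2
  refine Subtype.ext ?_
  change A.e g⁻¹ * (r * s) = A.e g⁻¹ * r * (A.e g⁻¹ * s)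
  rw [A.e_mul_mul, ← mul_assoc (A.e g⁻¹) (A.e g⁻¹), (A.e_idem g⁻¹).eq, ← A.e_mul_mul, mul_assoc]

lemma ext_zero (g : G) : A.ext g 0 = 0 := by
  have := A.ext_add g 0 0
  rwa [add_zero, left_eq_add] at this

lemma e_mul_ext (g : G) (r : R) : A.e g * A.ext g r = A.ext g r :=
  (A.mem_D_iff _ _).mp (A.α g _).2

lemma ext_e_mul (g : G) (r : R) : A.ext g (A.e g⁻¹ * r) = A.ext g r := by
  unfold ext
  congr 2
  refine Subtype.ext ?_
  change A.e g⁻¹ * (A.e g⁻¹ * r) = A.e g⁻¹ * r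
  rw [← mul_assoc, (A.e_idem g⁻¹).eq]

lemma ext_e (g h : G) : A.ext g (A.e h) = A.e g * A.e (g * h) := by
  have him := A.image_α g h
  have h1 : A.ext g (A.e h) ∈ (A.D g : Set R) ∩ A.D (g * h) := by
    rw [← him]
    exact ⟨_, (A.D h).mul_mem_left _ _ (A.e_mem h), rfl⟩
  have h2 : A.e g * A.e (g * h) ∈ (A.D g : Set R) ∩ A.D (g * h) :=
    ⟨(A.D g).mul_mem_right _ _ (A.e_mem g), (A.D _).mul_mem_left _ _ (A.e_mem _)⟩
  rw [← him] at h2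
  obtain ⟨x, hx, hx'⟩ := h2
  have hx1 : A.e h * (x : R) = x := (A.mem_D_iff _ _).mp hx
  simp only [A.α_eq_ext] at hx'
  have h3 : A.e (g * h) * A.ext g (A.e h) = A.ext g (A.e h) := (A.mem_D_iff _ _).mp h1.2
  calc A.ext g (A.e h) = A.e g * (A.e (g * h) * A.ext g (A.e h)) := by rw [h3, e_mul_ext]
    _ = A.ext g (A.e h) * (A.e g * A.e (g * h)) := by
        rw [A.e_comm (g * h), ← mul_assoc, A.e_comm g, mul_assoc]
    _ = A.ext g (A.e h * x) := by rw [ext_mul, hx']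
    _ = _ := by rw [hx1, hx']

lemma e_mul_tw (g h : G) : A.e g * A.tw g h = A.tw g h := (A.mem_D_iff _ _).mp (A.tw_mem g h).1

lemma e_mul_tw' (g h : G) : A.e (g * h) * A.tw g h = A.tw g h :=
  (A.mem_D_iff _ _).mp (A.tw_mem g h).2

lemma ext_ext_mul_tw (g h : G) (a : R) :
    A.ext g (A.ext h a) * A.tw g h = A.tw g h * A.ext (g * h) a := by
  set b := A.e h⁻¹ * (A.e (g * h)⁻¹ * a) with hb
  have h₁ : b ∈ A.D h⁻¹ := (A.D _).mul_mem_right _ _ (A.e_mem _)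
  have h₂ : b ∈ A.D (g * h)⁻¹ :=
    (A.D _).mul_mem_left _ _ ((A.D _).mul_mem_right _ _ (A.e_mem _))
  have hext : A.ext h b = A.e g⁻¹ * A.ext h a := by
    rw [hb, ext_e_mul, ext_mul, ext_e, mul_inv_rev, mul_inv_cancel_left, A.e_comm h, mul_assoc,
      e_mul_ext]
  have h₃ : (A.α h ⟨b, h₁⟩ : R) ∈ A.D g⁻¹ := by
    rw [α_eq_ext, hext]
    exact (A.D _).mul_mem_right _ _ (A.e_mem _)
  have key := A.α_α g h b h₁ h₂ h₃
  simp only [α_eq_ext] at key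
  rw [hext, ext_e_mul] at key
  have hgh : A.ext (g * h) b = A.e g * A.ext (g * h) a := by
    rw [hb, ext_mul, ext_e_mul, ext_e, mul_inv_cancel_right, A.e_comm (g * h), mul_assoc,
      e_mul_ext]
  rw [key, mul_assoc, A.twInv_mul_tw, hgh]
  have hE : A.ext (g * h) a * A.e (g * h) = A.ext (g * h) a := by rw [← e_comm, e_mul_ext]
  have hT : A.tw g h * A.e g = A.tw g h := by rw [← e_comm, e_mul_tw]
  calc A.tw g h * (A.e g * A.ext (g * h) a) * (A.e g * A.e (g * h))
      = A.tw g h * A.e g * (A.ext (g * h) a * A.e g) * A.e (g * h) := by simp only [mul_assoc]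
    _ = A.tw g h * (A.e g * A.ext (g * h) a) * A.e (g * h) := by rw [hT, ← A.e_comm g]
    _ = A.tw g h * A.e g * (A.ext (g * h) a * A.e (g * h)) := by simp only [mul_assoc]
    _ = _ := by rw [hT, hE]

lemma ext_mul_tw_mul_tw (g h t : G) (a : R) :
    A.ext g (a * A.tw h t) * A.tw g (h * t) = A.ext g a * A.tw g h * A.tw (g * h) t := by
  set b := A.e g⁻¹ * (A.e h * (A.e (h * t) * a)) with hb
  have h₁ : b ∈ A.D g⁻¹ := (A.D _).mul_mem_right _ _ (A.e_mem _)
  have h₂ : b ∈ A.D h := (A.D _).mul_mem_left _ _ ((A.D _).mul_mem_right _ _ (A.e_mem _))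
  have h₃ : b ∈ A.D (h * t) :=
    (A.D _).mul_mem_left _ _ ((A.D _).mul_mem_left _ _ ((A.D _).mul_mem_right _ _ (A.e_mem _)))
  have key := A.cocycle g h t b h₁ h₂ h₃
  simp only [α_eq_ext] at key
  have hL : A.ext g (b * A.tw h t) = A.ext g (a * A.tw h t) := by
    rw [hb, mul_assoc, ext_e_mul, e_mul_mul, e_mul_tw, e_mul_mul, e_mul_tw']
  have hR : A.ext g b = A.e (g * h) * (A.e (g * h * t) * A.ext g a) := by
    have h5 (y : R) : A.e g * (A.e (g * h) * y) = A.e (g * h) * (A.e g * y) := by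
      rw [← mul_assoc, e_mul_mul]
    have h6 : A.e g * (A.e (g * h * t) * A.ext g a) = A.e (g * h * t) * A.ext g a := by
      rw [← mul_assoc, e_mul_mul, e_mul_ext]
    rw [hb, ext_e_mul, ext_mul, ext_mul, ext_e, ext_e, mul_assoc (A.e g), mul_assoc (A.e g),
      ← mul_assoc g h t, h6, h5, h6]
  rw [hL, hR] at key
  rw [key, e_mul_mul, e_mul_tw', mul_assoc (A.e _), e_mul_mul, e_mul_tw']

/-- The product of homogeneous elements:
`(a δ_g) (b δ_h) = α_g (α_g⁻¹(a) b) w_{g,h} δ_{gh}`. -/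
def homMul {g h : G} (a : A.D g) (b : A.D h) : A.D (g * h) :=
  ⟨A.α g ⟨((A.α g).symm a : R) * b, (A.D g⁻¹).mul_mem_right _ _ ((A.α g).symm a).2⟩ * A.tw g h,
    (A.D (g * h)).mul_mem_left _ _ (A.tw_mem g h).2⟩

lemma coe_homMul {g h : G} (a : A.D g) (b : A.D h) :
    (A.homMul a b : R) = a * A.ext g b * A.tw g h := by
  simp only [homMul, α_eq_ext, ext_mul]
  rw [← α_eq_ext, RingEquiv.apply_symm_apply]

lemma one_mem : (1 : R) ∈ A.D 1 := by
  rw [A.D_one]; exact trivial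

lemma e_one : A.e 1 = 1 := by
  simpa using (A.mem_D_iff _ _).mp A.one_mem

lemma ext_one (r : R) : A.ext 1 r = r := by
  rw [ext, A.α_one]
  simp [A.e_one]

end UnitalTwistedPartialAction

/-- The homogeneous components `D_g δ_g`, indexed by `g` (as an element of `Additive G`, as the
index set of a graded ring is written additively in Mathlib). -/
abbrev UnitalTwistedPartialAction.Component {G : Type v} {R : Type u} [Group G] [Ring R]
    (A : UnitalTwistedPartialAction G R) (g : Additive G) : Type u :=
  A.D g.toMul

namespace UnitalTwistedPartialAction

variable {G : Type v} {R : Type u} [Group G] [Ring R] (A : UnitalTwistedPartialAction G R)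

lemma component_ext {g h : Additive G} (hgh : g = h) {a : A.Component g} {b : A.Component h}
    (hab : (a : R) = b) : GradedMonoid.mk (A := A.Component) g a = GradedMonoid.mk h b := by
  subst hgh
  exact congrArg _ (Subtype.ext hab)

instance : GradedMonoid.GMul A.Component where
  mul a b := A.homMul a b

instance : GradedMonoid.GOne A.Component where
  one := ⟨1, A.one_mem⟩

instance : DirectSum.GRing A.Component where
  mul_zero a := Subtype.ext (by
    change (A.homMul a 0 : R) = 0
    rw [coe_homMul]
    change (a : R) * A.ext _ 0 * _ = 0
    rw [ext_zero, mul_zero, zero_mul])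
  zero_mul b := Subtype.ext (by
    change (A.homMul 0 b : R) = 0
    rw [coe_homMul]
    change (0 : R) * _ * _ = 0
    rw [zero_mul, zero_mul])
  mul_add a b c := Subtype.ext (by
    change (A.homMul a (b + c) : R) = A.homMul a b + A.homMul a c
    simp only [coe_homMul]
    change (a : R) * A.ext _ (b + c) * _ = _
    rw [ext_add, mul_add, add_mul])
  add_mul a b c := Subtype.ext (by
    change (A.homMul (a + b) c : R) = A.homMul a c + A.homMul b c
    simp only [coe_homMul]
    change ((a : R) + b) * _ * _ = _
    rw [add_mul, add_mul])
  one_mul := fun ⟨g, a⟩ => A.component_ext (zero_add g) (by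
    change (A.homMul (g := 1) ⟨1, A.one_mem⟩ (h := g.toMul) a : R) = a
    rw [coe_homMul, ext_one, A.tw_one_left, one_mul, ← A.e_comm]
    exact (A.mem_D_iff _ _).mp a.2)
  mul_one := fun ⟨g, a⟩ => A.component_ext (add_zero g) (by
    change (A.homMul (g := g.toMul) a (h := 1) ⟨1, A.one_mem⟩ : R) = a
    rw [coe_homMul]
    change (a : R) * A.ext _ 1 * _ = a
    have ha : A.e g.toMul * (a : R) = a := (A.mem_D_iff _ _).mp a.2
    rw [← A.e_one, ext_e, mul_one, A.tw_one_right, A.e_idem, mul_assoc, A.e_idem, ← A.e_comm, ha])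
  mul_assoc := fun ⟨g, a⟩ ⟨h, b⟩ ⟨t, c⟩ => A.component_ext (add_assoc g h t) (by
    change (A.homMul (g := g.toMul * h.toMul) (A.homMul (g := g.toMul) (h := h.toMul) a b)
        (h := t.toMul) c : R) =
      A.homMul (g := g.toMul) a (h := h.toMul * t.toMul) (A.homMul (g := h.toMul) (h := t.toMul) b c)
    simp only [coe_homMul]
    rw [mul_assoc (a : R) (A.ext _ (_ * _)), ext_mul_tw_mul_tw, ext_mul,
      mul_assoc _ (A.ext _ (A.ext _ _)), ext_ext_mul_tw]
    simp only [mul_assoc])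
  natCast n := ⟨n, by rw [toMul_zero, A.D_one]; exact trivial⟩
  natCast_zero := Subtype.ext Nat.cast_zero
  natCast_succ n := Subtype.ext (Nat.cast_succ n)
  intCast n := ⟨n, by rw [toMul_zero, A.D_one]; exact trivial⟩
  intCast_ofNat n := Subtype.ext (Int.cast_natCast n)
  intCast_negSucc_ofNat n := Subtype.ext (Int.cast_negSucc n)

/-- The partial crossed product `R *_{α,w} G = ⨁_{g ∈ G} D_g δ_g`. -/
abbrev CrossedProduct : Type (max u v) := DirectSum (Additive G) A.Component

open Classical in
/-- The ring structure of the partial crossed product: its multiplication is the biadditive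
extension of `homMul`, and its identity element is `1_R δ_1`. -/
noncomputable instance : Ring A.CrossedProduct := DirectSum.ring A.Component

open Classical in
lemma of_mul_of (g h : G) (a : A.D g) (b : A.D h) :
    (DirectSum.of A.Component (Additive.ofMul g) a * DirectSum.of A.Component (Additive.ofMul h) b :
      A.CrossedProduct) = DirectSum.of A.Component (Additive.ofMul (g * h)) (A.homMul a b) :=
  DirectSum.of_mul_of (A := A.Component) (i := Additive.ofMul g) (j := Additive.ofMul h) a b

open Classical in
lemma one_eq_of :
    (1 : A.CrossedProduct) = DirectSum.of A.Component (Additive.ofMul 1) ⟨1, A.one_mem⟩ := rfl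

end UnitalTwistedPartialAction

/-- The left global dimension of a ring: the supremum of the projective dimensions of its left
modules. The modules range over the universe `max u w`, where `u` is the universe of the ring and
`w` is arbitrary, so that rings of different universes can be compared over modules of one and the
same universe. -/
noncomputable def leftGlobalDim (R : Type u) [Ring R] : WithBot ℕ∞ :=
  ⨆ M : ModuleCat.{max u w} R, projectiveDimension M

/-- A ring is (left) hereditary if every left module has a projective resolution of length at
most one, that is, has projective dimension at most one. -/
def IsLeftHereditary (R : Type u) [Ring R] : Prop :=
  ∀ M : ModuleCat.{max u w} R, projectiveDimension M ≤ 1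

/-! Write `S` for the partial crossed product, an extension of `R` through `r ↦ r δ_1`. Two
comparisons carry the theorem.

Restriction of `S`-modules to `R` preserves and reflects projectivity. It preserves it because `S`
is the direct sum of the `D_g = R 1_g`, each a summand of `R`. It reflects it by Maschke's argument:
an `R`-linear splitting is averaged over `G` (`projective_crossedProduct`). As `∑ α_g(1_{g⁻¹}) = ∑
1_g` need not be `|G|`, the average is weighted by a central `c` with `∑ α_g(1_{g⁻¹} c) = 1`;
finding `c` is where `|G|` must be invertible (`exists_sum_ext_eq_one`). Dimension shifting then
gives `pd_R N = pd_S N` for every `S`-module `N`.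

Conversely, `R` is an `R`-bimodule summand of `S`, so every `R`-module `M` is a retract of `Hom_R(S,
M)`, whence `pd_R M ≤ pd_S Hom_R(S, M)`. Semisimplicity follows from the same two facts, applied to
projectivity of cyclic modules. -/

/-! ### Generalities on projectivity and semisimplicity -/

section RingExtension

variable {R S : Type*} [Ring R] [Ring S]

/-- Over a ring extension that is projective as a left module, projectivity descends along
restriction of scalars. -/
theorem Module.Projective.restrictScalars_of_isScalarTower [Module R S] [Module.Projective R S]
    {P : Type*} [AddCommGroup P] [Module S P] [Module R P] [IsScalarTower R S P]
    [IsScalarTower R S S] [Module.Projective S P] : Module.Projective R P := by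
  classical
  obtain ⟨s, hs⟩ := Module.projective_def'.mp ‹Module.Projective S P›
  have : Module.Projective R (P →₀ S) :=
    Module.Projective.of_equiv (finsuppLequivDFinsupp (ι := P) (M := S) R).symm
  exact Module.Projective.of_split (s.restrictScalars R)
    ((Finsupp.linearCombination S id).restrictScalars R)
    (LinearMap.ext fun x => LinearMap.congr_fun hs x)

/-- A ring all of whose cyclic left modules are projective is semisimple. -/
theorem isSemisimpleRing_of_projective_quotient
    (h : ∀ I : Submodule R R, Module.Projective R (R ⧸ I)) : IsSemisimpleRing R := by
  rw [IsSemisimpleRing, isSemisimpleModule_iff]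
  refine ⟨fun I => ?_⟩
  have := h I
  obtain ⟨g, hg⟩ := I.mkQ.exists_rightInverse_of_surjective I.range_mkQ
  -- With `g` a section of `R → R ⧸ I`, the map `1 - g ∘ mkQ` is a projection of `R` onto `I`; its
  -- kernel is the complement.
  have hmem (x : R) : ((LinearMap.id : R →ₗ[R] R) - g ∘ₗ I.mkQ) x ∈ I := by
    rw [← Submodule.Quotient.mk_eq_zero, ← Submodule.mkQ_apply]
    simpa [sub_eq_zero] using (LinearMap.congr_fun hg (I.mkQ x)).symm
  refine ⟨_, LinearMap.isCompl_of_proj (f := ((LinearMap.id : R →ₗ[R] R) - g ∘ₗ I.mkQ).codRestrict I hmem)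
    fun x => Subtype.ext ?_⟩
  simp [(Submodule.Quotient.mk_eq_zero I).mpr x.2]

end RingExtension

/-! ### Projective dimension under change of rings -/

namespace ModuleCat

variable {R : Type u} {S : Type v} [Ring R] [Ring S] (f : R →+* S)

theorem shortExact_map_restrictScalars {X : ShortComplex (ModuleCat.{w} S)} (hX : X.ShortExact) :
    (X.map (restrictScalars f)).ShortExact where
  exact := by
    have := hX.exact
    rw [CategoryTheory.ShortComplex.ShortExact.moduleCat_exact_iff_function_exact] at this ⊢
    exact this
  mono_f := (mono_iff_injective _).mpr ((mono_iff_injective X.f).mp hX.mono_f)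
  epi_g := (epi_iff_surjective _).mpr ((epi_iff_surjective X.g).mp hX.epi_g)

/-- Dimension shifting along a projective presentation, which restriction keeps exact with
projective middle term. The shift starts only at `n + 2`: the kernel of a presentation of a
projective module need not vanish, so `n = 1` is the hypothesis itself. -/
theorem hasProjectiveDimensionLT_restrictScalars_iff
    (h : ∀ M : ModuleCat.{max v w} S, Projective M ↔ Projective ((restrictScalars f).obj M))
    (n : ℕ) (M : ModuleCat.{max v w} S) :
    HasProjectiveDimensionLT M n ↔
      HasProjectiveDimensionLT ((restrictScalars f).obj M) n := by
  match n with
  | 0 =>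
    rw [hasProjectiveDimensionLT_zero_iff_isZero, hasProjectiveDimensionLT_zero_iff_isZero,
      isZero_iff_subsingleton, isZero_iff_subsingleton]
    exact Iff.rfl
  | 1 =>
    rw [← projective_iff_hasProjectiveDimensionLT_one, ← projective_iff_hasProjectiveDimensionLT_one]
    exact h M
  | n + 2 =>
    let P := M.projectiveShortComplex
    have hP := M.shortExact_projectiveShortComplex
    have hP' := shortExact_map_restrictScalars f hP
    have h₂ : Projective P.X₂ := inferInstance
    rw [hP.hasProjectiveDimensionLT_X₃_iff n h₂,
      hasProjectiveDimensionLT_restrictScalars_iff h (n + 1)]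
    exact (hP'.hasProjectiveDimensionLT_X₃_iff n ((h _).mp h₂)).symm

theorem projectiveDimension_restrictScalars
    (h : ∀ M : ModuleCat.{max v w} S, Projective M ↔ Projective ((restrictScalars f).obj M))
    (M : ModuleCat.{max v w} S) :
    projectiveDimension ((restrictScalars f).obj M) = projectiveDimension M := by
  simp only [projectiveDimension, hasProjectiveDimensionLT_restrictScalars_iff f h]

/-- If `R` is a direct summand of `S` as an `R`-bimodule, then every left `R`-module is a direct
summand of an `S`-module, namely of its coextension of scalars. -/
noncomputable def retractRestrictScalarsCoextendScalars (π : S →+ R) (hl : ∀ r s, π (f r * s) = r * π s)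
    (hr : ∀ r s, π (s * f r) = π s * r) (h1 : π 1 = 1) (M : ModuleCat.{max v w} R) :
    Retract M ((restrictScalars f).obj ((coextendScalars f).obj M)) where
  i := ofHom (Y := (restrictScalars f).obj ((coextendScalars f).obj M))
    -- The inclusion is `m ↦ (s ↦ π s • m)`: `hl` makes the inner map `R`-linear, `hr` the outer
    -- one. The retraction is evaluation at `1`.
    { toFun := fun m => (CoextendScalars.equiv f M).symm
        { toFun := fun s : S => π s • m
          map_add' := fun s t : S => by rw [← add_smul, ← map_add]; rfl
          map_smul' := fun r (s : S) => by
            rw [RingHom.id_apply, smul_smul, ← hl]; rfl }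
      map_add' := fun m m' => CoextendScalars.ext <| LinearMap.ext fun s : S => smul_add _ _ _
      map_smul' := fun r m => CoextendScalars.ext <| LinearMap.ext fun s : S => by
        change π s • r • m = π (s * f r) • m
        rw [hr, smul_smul] }
  r := RestrictionCoextensionAdj.HomEquiv.toRestriction f (𝟙 _)
  retract := by
    ext m
    change π 1 • m = m
    rw [h1, one_smul]

end ModuleCat

/-! ### Homogeneous elements and the bimodule splitting -/

namespace UnitalTwistedPartialAction

variable {G : Type v} {R : Type u} [Group G] [Ring R] (A : UnitalTwistedPartialAction G R)

open scoped Classical in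
/-- The homogeneous element `(1_g r) δ_g` of the partial crossed product. -/
noncomputable def single (g : G) (r : R) : A.CrossedProduct :=
  DirectSum.of A.Component (Additive.ofMul g)
    ⟨A.e g * r, (A.D g).mul_mem_right _ _ (A.e_mem g)⟩

open scoped Classical in
lemma of_eq_single (g : G) (a : A.D g) :
    DirectSum.of A.Component (Additive.ofMul g) a = A.single g a :=
  congrArg _ (Subtype.ext ((A.mem_D_iff _ _).mp a.2).symm)

lemma single_congr {g h : G} {r s : R} (hgh : g = h) (hrs : A.e h * r = A.e h * s) :
    A.single g r = A.single h s := by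
  subst hgh
  rw [single, single]
  exact congrArg _ (Subtype.ext hrs)

lemma single_add (g : G) (r s : R) : A.single g (r + s) = A.single g r + A.single g s := by
  rw [single, single, single, ← map_add]
  exact congrArg _ (Subtype.ext (mul_add _ _ _))

lemma single_mul_single (g h : G) (r s : R) :
    A.single g r * A.single h s = A.single (g * h) (r * A.ext g s * A.tw g h) := by
  rw [single, single, A.of_mul_of]
  refine congrArg _ (Subtype.ext ?_)
  rw [coe_homMul]
  change A.e g * r * A.ext g (A.e h * s) * A.tw g h = A.e (g * h) * (r * A.ext g s * A.tw g h)
  calc A.e g * r * A.ext g (A.e h * s) * A.tw g h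
      = r * (A.e g * (A.e g * (A.e (g * h) * (A.ext g s * A.tw g h)))) := by
        rw [ext_mul, ext_e]; simp only [mul_assoc]; rw [← mul_assoc, e_mul_mul]
    _ = r * (A.e (g * h) * (A.e g * (A.e g * (A.ext g s * A.tw g h)))) := by
        simp only [← A.e_mul_mul (g * h), ← mul_assoc]
    _ = A.e (g * h) * (r * A.ext g s * A.tw g h) := by
        simp only [← mul_assoc, ← A.e_comm (g * h)]
        simp only [mul_assoc]
        rw [← mul_assoc (A.e g) (A.ext g s), e_mul_ext, ← mul_assoc (A.e g), e_mul_ext]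

/-- The embedding `r ↦ r δ_1` of `R` into the partial crossed product. -/
noncomputable def toCrossedProduct : R →+* A.CrossedProduct where
  toFun := A.single 1
  map_one' := by
    rw [one_eq_of, of_eq_single]
  map_mul' r s := by
    rw [single_mul_single, ext_one, tw_one_left, e_one, mul_one, mul_one]
  map_zero' := by
    rw [← add_eq_left (a := A.single 1 0), ← single_add, add_zero]
  map_add' := A.single_add 1

lemma toCrossedProduct_apply (r : R) : A.toCrossedProduct r = A.single 1 r := rfl

lemma toCrossedProduct_mul_single (g : G) (r s : R) :
    A.toCrossedProduct r * A.single g s = A.single g (r * s) := by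
  rw [toCrossedProduct_apply, single_mul_single, ext_one, tw_one_left]
  exact A.single_congr (one_mul g) (by rw [← e_comm, ← mul_assoc, A.e_idem])

lemma single_mul_toCrossedProduct (g : G) (r s : R) :
    A.single g s * A.toCrossedProduct r = A.single g (s * A.ext g r) := by
  rw [toCrossedProduct_apply, single_mul_single, tw_one_right]
  exact A.single_congr (mul_one g) (by rw [← e_comm, ← mul_assoc, A.e_idem])

open scoped Classical in
@[elab_as_elim]
lemma crossedProduct_induction {p : A.CrossedProduct → Prop} (zero : p 0)
    (single : ∀ g r, p (A.single g r)) (add : ∀ x y, p x → p y → p (x + y))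
    (x : A.CrossedProduct) : p x := by
  induction x using DirectSum.induction_on with
  | zero => exact zero
  | of g a => exact (A.of_eq_single g.toMul a) ▸ single _ _
  | add x y hx hy => exact add x y hx hy

open scoped Classical in
-- Reconciles the componentwise `R`-action, for which projectivity is visible, with the action by
-- restriction of scalars.
lemma smul_eq_toCrossedProduct_mul (r : R) (x : A.CrossedProduct) :
    r • x = A.toCrossedProduct r * x := by
  induction x using A.crossedProduct_induction with
  | zero => simp
  | single g s =>
    rw [toCrossedProduct_mul_single, single, single, ← DirectSum.lof_eq_of R, ← map_smul]
    refine congrArg _ (Subtype.ext ?_)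
    change r * (A.e g * s) = A.e g * (r * s)
    rw [← mul_assoc (A.e g), e_mul_mul]
  | add x y hx hy => rw [smul_add, mul_add, hx, hy]

instance : IsScalarTower R A.CrossedProduct A.CrossedProduct where
  smul_assoc r x y := by
    simp only [smul_eq_mul, smul_eq_toCrossedProduct_mul, mul_assoc]

/-- Multiplication by `1_g` retracts `R` onto `D_g`. -/
instance (g : Additive G) : Module.Projective R (A.Component g) :=
  Module.Projective.of_split (M := R)
    { toFun := fun a => (a : R)
      map_add' := fun _ _ => rfl
      map_smul' := fun _ _ => rfl }
    { toFun := fun r => ⟨A.e g.toMul * r, (A.D _).mul_mem_right _ _ (A.e_mem _)⟩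
      map_add' := fun r s => Subtype.ext (mul_add _ _ _)
      map_smul' := fun r s => Subtype.ext (by
        change A.e _ * (r * s) = r * (A.e _ * s)
        rw [← mul_assoc, e_mul_mul]) }
    (LinearMap.ext fun a => Subtype.ext ((A.mem_D_iff _ _).mp a.2))

/-- The projection of the partial crossed product onto its component of degree `1`. -/
noncomputable def coeffOne : A.CrossedProduct →+ R :=
  (AddSubgroupClass.subtype (A.D 1)).comp
    (DFinsupp.evalAddMonoidHom (β := A.Component) (Additive.ofMul 1))

open scoped Classical in
lemma coeffOne_single_one (r : R) : A.coeffOne (A.single 1 r) = r := by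
  change ((DirectSum.of A.Component (Additive.ofMul 1) _ : A.CrossedProduct) _ : R) = r
  rw [DirectSum.of_eq_same]
  change A.e 1 * r = r
  rw [e_one, one_mul]

open scoped Classical in
lemma coeffOne_single_of_ne {g : G} (hg : g ≠ 1) (r : R) : A.coeffOne (A.single g r) = 0 := by
  change ((DirectSum.of A.Component (Additive.ofMul g) _ : A.CrossedProduct) _ : R) = 0
  rw [DirectSum.of_eq_of_ne]
  · rfl
  · exact fun h => hg h.symm

/-- Multiplying by `r δ_1` preserves degrees. With the right-hand analogue below, which uses that
`α_1` is the identity, this makes `coeffOne` a bimodule map. -/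
lemma coeffOne_toCrossedProduct_mul (r : R) (x : A.CrossedProduct) :
    A.coeffOne (A.toCrossedProduct r * x) = r * A.coeffOne x := by
  induction x using A.crossedProduct_induction with
  | zero => simp
  | single g s =>
    rw [toCrossedProduct_mul_single]
    by_cases hg : g = 1
    · subst hg; simp only [coeffOne_single_one]
    · simp only [A.coeffOne_single_of_ne hg, mul_zero]
  | add x y hx hy => simp only [mul_add, map_add, hx, hy]

lemma coeffOne_mul_toCrossedProduct (r : R) (x : A.CrossedProduct) :
    A.coeffOne (x * A.toCrossedProduct r) = A.coeffOne x * r := by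
  induction x using A.crossedProduct_induction with
  | zero => simp
  | single g s =>
    rw [single_mul_toCrossedProduct]
    by_cases hg : g = 1
    · subst hg; simp only [coeffOne_single_one, ext_one]
    · simp only [A.coeffOne_single_of_ne hg, zero_mul]
  | add x y hx hy => simp only [add_mul, map_add, hx, hy]

/-- The element `w_{g⁻¹,g}⁻¹ δ_{g⁻¹}`, a one-sided inverse of `1_g δ_g` up to the
idempotent `1_g`. -/
noncomputable def singleInv (g : G) : A.CrossedProduct := A.single g⁻¹ (A.twInv g⁻¹ g)

lemma e_mul_single (g : G) (r : R) :
    A.toCrossedProduct (A.e g) * A.single g r = A.single g r := by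
  rw [toCrossedProduct_mul_single]
  exact A.single_congr rfl (by rw [← mul_assoc, A.e_idem])

lemma single_mul_e (g : G) (r : R) :
    A.single g r * A.toCrossedProduct (A.e g⁻¹) = A.single g r := by
  rw [single_mul_toCrossedProduct, ext_e, mul_inv_cancel, e_one, mul_one]
  exact A.single_congr rfl (by rw [← e_comm, ← mul_assoc, A.e_idem])

lemma single_mul_singleInv (g : G) :
    A.single g 1 * A.singleInv g = A.toCrossedProduct (A.e g) := by
  -- In the cocycle identity at `(g, g⁻¹, g)` with `a = w_{g⁻¹,g}⁻¹`, the left side collapses to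
  -- `1_g` and the right side to the coefficient of the product sought.
  have key := A.ext_mul_tw_mul_tw g g⁻¹ g (A.twInv g⁻¹ g)
  rw [twInv_mul_tw, inv_mul_cancel, mul_inv_cancel, e_one, mul_one, ext_e, mul_inv_cancel, e_one,
    mul_one, tw_one_left, tw_one_right, A.e_idem, ← A.e_comm, ← mul_assoc, e_mul_ext] at key
  rw [singleInv, single_mul_single, one_mul, ← key, mul_inv_cancel, toCrossedProduct_apply]

/-- A factor of degree `h` moves the index `g` to `h g` at the cost of one element `s` of `R`, the
same on both sides. An `R`-linear map lets `s` pass, which makes the average linear over the crossed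
product. -/
lemma exists_single_mul_eq (g h : G) (r : R) :
    ∃ s : R,
      A.single h r * A.single g 1 = A.single (h * g) 1 * A.toCrossedProduct s ∧
      A.singleInv (h * g) * A.single h r = A.toCrossedProduct s * A.singleInv g := by
  obtain ⟨s, hs⟩ : ∃ s : R, A.singleInv (h * g) * (A.single h r * A.single g 1) =
      A.toCrossedProduct s := by
    rw [single_mul_single, singleInv, single_mul_single]
    exact ⟨_, A.single_congr (inv_mul_cancel _) rfl⟩
  refine ⟨s, ?_, ?_⟩
  · rw [← hs, ← mul_assoc, single_mul_singleInv, single_mul_single, e_mul_single]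
  · rw [← hs, mul_assoc, mul_assoc, single_mul_singleInv, singleInv, single_mul_single,
      ← mul_assoc, single_mul_single]
    have h1 : (h * g)⁻¹ * h = g⁻¹ := by group
    rw [h1]
    nth_rw 1 [← A.single_mul_e g⁻¹]
    rw [inv_inv]

/-! ### Averaging and Maschke's theorem -/

section Averaging

variable {M N : Type*} [AddCommGroup M] [Module A.CrossedProduct M] [Module R M]
  [IsScalarTower R A.CrossedProduct M] [AddCommGroup N] [Module A.CrossedProduct N] [Module R N]
  [IsScalarTower R A.CrossedProduct N]

lemma toCrossedProduct_smul (r : R) (m : M) : A.toCrossedProduct r • m = r • m := by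
  rw [← mul_one (A.toCrossedProduct r), ← smul_eq_toCrossedProduct_mul, smul_assoc, one_smul]

variable [Fintype G]

/-- The average `∑ δ_g f(δ_g⁻¹ m)` of an `R`-linear map `f`, which is linear over the partial
crossed product. -/
noncomputable def average (f : M →ₗ[R] N) : M →ₗ[A.CrossedProduct] N where
  toFun m := ∑ g : G, A.single g 1 • f (A.singleInv g • m)
  map_add' m n := by simp only [smul_add, map_add, Finset.sum_add_distrib]
  map_smul' x m := by
    rw [RingHom.id_apply]
    induction x using A.crossedProduct_induction with
    | zero => simp
    | single h r =>
      -- After the substitution `g ↦ h g` the two sums agree term by term.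
      rw [Finset.smul_sum, ← Equiv.sum_comp (Equiv.mulLeft h)]
      refine Finset.sum_congr rfl fun g _ => ?_
      obtain ⟨s, hs, hs'⟩ := A.exists_single_mul_eq g h r
      rw [Equiv.coe_mulLeft, smul_smul, smul_smul, hs, hs', mul_smul, mul_smul,
        toCrossedProduct_smul, toCrossedProduct_smul, map_smul]
    | add x y hx hy => simp only [add_smul, smul_add, map_add, Finset.sum_add_distrib, hx, hy]

lemma average_apply (f : M →ₗ[R] N) (m : M) :
    A.average f m = ∑ g : G, A.single g 1 • f (A.singleInv g • m) := rfl

/-- **Maschke's theorem** for partial crossed products. -/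
theorem projective_crossedProduct {c : R} (hc : c ∈ Subring.center R)
    (htr : ∑ g : G, A.ext g c = 1) [Module.Projective R M] :
    Module.Projective A.CrossedProduct M := by
  refine Module.Projective.of_lifting_property'' fun f hf => ?_
  obtain ⟨s, hs⟩ := Module.projective_lifting_property (f.restrictScalars R) LinearMap.id hf
  have hcomm (r : R) : r * c = c * r := Subring.mem_center_iff.mp hc r
  -- The weighted splitting `c • s` is still `R`-linear because `c` is central.
  let t : M →ₗ[R] (M →₀ A.CrossedProduct) :=
    { toFun := fun m => c • s m
      map_add' := fun m n => by rw [map_add, smul_add]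
      map_smul' := fun r m => by rw [map_smul, smul_smul, ← hcomm, mul_smul, RingHom.id_apply] }
  refine ⟨A.average t, LinearMap.ext fun m => ?_⟩
  have hsm (n : M) : f (s n) = n := LinearMap.congr_fun hs n
  -- Conjugating `c` by `δ_g` gives `α_g(1_{g⁻¹} c)`, so the composite with `f` is multiplication by
  -- the trace of `c`, which is `1`.
  have hg (g : G) : A.single g 1 • f (t (A.singleInv g • m)) = A.ext g c • m := by
    change A.single g 1 • f (c • s (A.singleInv g • m)) = _
    rw [← toCrossedProduct_smul A c, map_smul, hsm, smul_smul, smul_smul,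
      single_mul_toCrossedProduct, one_mul, ← mul_one (A.ext g c), ← toCrossedProduct_mul_single,
      mul_assoc, single_mul_singleInv, ← map_mul, ← e_comm, e_mul_ext, toCrossedProduct_smul,
      mul_one]
  simp only [LinearMap.comp_apply, average_apply, map_sum, map_smul, hg, ← Finset.sum_smul, htr,
    one_smul, LinearMap.id_apply]

end Averaging

/-! ### A central element of trace one -/

section TraceOne

/-- The extended `α_g` is multiplicative and sends `1` to `1_g` and `1_h` to `1_g 1_{gh}`, hence `1
- 1_h` to `1_g (1 - 1_{gh})`. The products are formed in the center, where they commute. -/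
lemma ext_prod_one_sub_e (g : G) {ι : Type*} (s : Finset ι) (φ : ι → G) :
    A.ext g (∏ i ∈ s, (1 - ⟨A.e (φ i), A.e_central _⟩ : Subring.center R) : Subring.center R) =
      A.e g *
        (∏ i ∈ s, (1 - ⟨A.e (g * φ i), A.e_central _⟩ : Subring.center R) : Subring.center R) := by
  classical
  have h1 : A.ext g 1 = A.e g := by rw [← A.e_one, ext_e, mul_one, A.e_idem]
  induction s using Finset.induction_on with
  | empty => simp [h1]
  | insert a s ha ih =>
    have h2 : A.ext g (1 - A.e (φ a)) = A.e g * (1 - A.e (g * φ a)) := by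
      rw [eq_comm, ← add_left_inj (A.ext g (A.e (φ a))), ← ext_add, sub_add_cancel, h1, ext_e]
      noncomm_ring
    rw [Finset.prod_insert ha, Finset.prod_insert ha]
    push_cast
    rw [ext_mul, ih, h2, ← mul_assoc, ← mul_assoc, mul_assoc _ _ (A.e g), ← A.e_comm g,
      ← mul_assoc, A.e_idem]

/-- If the order of `G` is invertible, then there is a central element of trace one. -/
theorem exists_sum_ext_eq_one [Fintype G] (hG : IsUnit (Nat.card G : R)) :
    ∃ c ∈ Subring.center R, ∑ g : G, A.ext g c = 1 := by
  classical
  -- Any linear order will do; it serves to break up the union of the idempotents into orthogonal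
  -- pieces.
  let : LinearOrder G := linearOrderOfSTO (WellOrderingRel (α := G))
  let ε (g : G) : Subring.center R := ⟨A.e g, A.e_central g⟩
  let P (h m : G) : Subring.center R := ∏ k with k < h, (1 - ε (m * k))
  -- The sum telescopes to `1 - ∏ (1 - 1_{m⁻¹h})`, and the factor at `h = m` is `1 - 1_e = 0`.
  have hsum (m : G) : ∑ h, A.e (m⁻¹ * h) * (P h m⁻¹ : R) = 1 := by
    have := Finset.prod_one_sub_ordered Finset.univ fun h => ε (m⁻¹ * h)
    rw [Finset.prod_eq_zero (Finset.mem_univ m), eq_comm, sub_eq_zero] at this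
    · have := congrArg (Subtype.val : _ → R) this
      push_cast at this
      exact this.symm
    · rw [sub_eq_zero]
      exact Subtype.ext (by simp [ε, e_one])
  obtain ⟨i, hi, hi'⟩ : ∃ i ∈ Subring.center R, (Nat.card G : R) * i = 1 := by
    obtain ⟨a, ha⟩ := hG
    refine ⟨(a⁻¹ : Rˣ), Subring.mem_center_iff.mpr fun r => ?_, by rw [← ha, Units.mul_inv]⟩
    have : Commute (a : R) r := ha ▸ Nat.cast_commute _ r
    exact (this.units_inv_left).symm
  -- Additivity alone forces `α_g` to commute with division by `|G|`.
  have hext (g : G) (r : R) : A.ext g (i * r) = i * A.ext g r := by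
    have hn : (Nat.card G : R) * A.ext g (i * r) = A.ext g r := by
      rw [← nsmul_eq_mul]
      change _ • AddMonoidHom.mk' (A.ext g) (A.ext_add g) (i * r) = _
      rw [← map_nsmul, nsmul_eq_mul, ← mul_assoc, hi']
      simp
    rw [← hn, ← mul_assoc, ← Subring.mem_center_iff.mp hi (Nat.card G), hi', one_mul]
  have hP (g h : G) : A.ext g (P h h⁻¹ : R) = A.e g * (P h (g * h⁻¹) : R) := by
    simp only [P, ε, ext_prod_one_sub_e, mul_assoc]
  -- Each `P h h⁻¹` is chosen so that its translates, regrouped by `m = h g⁻¹`, are the terms of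
  -- `hsum`; each of the `|G|` values of `m` contributes `1`.
  refine ⟨i * (∑ h, P h h⁻¹ : Subring.center R), mul_mem hi (Subtype.prop _), ?_⟩
  have hadd (g : G) : A.ext g (∑ h, P h h⁻¹ : Subring.center R) =
      ∑ h, A.e g * (P h (g * h⁻¹) : R) := by
    change AddMonoidHom.mk' (A.ext g) (A.ext_add g) _ = _
    push_cast
    rw [map_sum]
    exact Finset.sum_congr rfl fun h _ => hP g h
  simp only [hext, hadd, ← Finset.mul_sum]
  have hswap : ∑ g, ∑ h, A.e g * (P h (g * h⁻¹) : R) = (Nat.card G : R) := by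
    rw [Finset.sum_comm]
    calc ∑ h, ∑ g, A.e g * (P h (g * h⁻¹) : R)
        = ∑ h, ∑ m, A.e (m⁻¹ * h) * (P h m⁻¹ : R) := by
          refine Finset.sum_congr rfl fun h _ => ?_
          rw [← Equiv.sum_comp ((Equiv.inv G).trans (Equiv.mulRight h))]
          simp
      _ = ∑ m, ∑ h, A.e (m⁻¹ * h) * (P h m⁻¹ : R) := Finset.sum_comm
      _ = Nat.card G := by simp only [hsum]; simp
  rw [← hswap] at hi'
  rw [← hi', Subring.mem_center_iff.mp hi]
  simp only [Finset.mul_sum]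

end TraceOne
end UnitalTwistedPartialAction

/-! ### Comparison of homological dimensions -/

namespace UnitalTwistedPartialAction

variable {G : Type v} {R : Type u} [Group G] [Ring R] (A : UnitalTwistedPartialAction G R)

lemma isScalarTower_restrictScalars (M : ModuleCat.{w} A.CrossedProduct) :
    IsScalarTower R A.CrossedProduct ((ModuleCat.restrictScalars A.toCrossedProduct).obj M) where
  smul_assoc r x m := by
    rw [smul_eq_toCrossedProduct_mul]
    exact mul_smul (A.toCrossedProduct r) x (m : M)

theorem projective_restrictScalars_iff [Finite G] (hG : IsUnit (Nat.card G : R))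
    (M : ModuleCat.{max u v w} A.CrossedProduct) :
    Projective M ↔ Projective ((ModuleCat.restrictScalars A.toCrossedProduct).obj M) := by
  have := Fintype.ofFinite G
  have := A.isScalarTower_restrictScalars M
  obtain ⟨c, hc, htr⟩ := A.exists_sum_ext_eq_one hG
  constructor
  · intro h
    have h1 : Module.Projective A.CrossedProduct M := inferInstance
    have h2 : Module.Projective A.CrossedProduct
      ((ModuleCat.restrictScalars A.toCrossedProduct).obj M) := h1
    have h3 := Module.Projective.restrictScalars_of_isScalarTower (R := R) (S := A.CrossedProduct)
      (P := (ModuleCat.restrictScalars A.toCrossedProduct).obj M)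
    infer_instance
  · intro h
    have h1 : Module.Projective R ((ModuleCat.restrictScalars A.toCrossedProduct).obj M) :=
      inferInstance
    have h2 : Module.Projective A.CrossedProduct M := A.projective_crossedProduct
      (M := (ModuleCat.restrictScalars A.toCrossedProduct).obj M) hc htr
    infer_instance

theorem projectiveDimension_restrictScalars [Finite G] (hG : IsUnit (Nat.card G : R))
    (M : ModuleCat.{max u v w} A.CrossedProduct) :
    projectiveDimension ((ModuleCat.restrictScalars A.toCrossedProduct).obj M) =
      projectiveDimension M :=
  ModuleCat.projectiveDimension_restrictScalars.{max u v w} A.toCrossedProduct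
    (A.projective_restrictScalars_iff hG) M

/-- Every left module over the base ring is a direct summand of its coextension of scalars to the
partial crossed product. -/
noncomputable def retractCoextendScalars (M : ModuleCat.{max u v w} R) :
    Retract M ((ModuleCat.restrictScalars A.toCrossedProduct).obj
      ((ModuleCat.coextendScalars A.toCrossedProduct).obj M)) :=
  ModuleCat.retractRestrictScalarsCoextendScalars.{max u v w} A.toCrossedProduct A.coeffOne
    A.coeffOne_toCrossedProduct_mul A.coeffOne_mul_toCrossedProduct
    (by rw [← map_one A.toCrossedProduct]; exact A.coeffOne_single_one 1) M

/-- Every left module over the base ring has projective dimension at most that of a left module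
over the partial crossed product. -/
theorem exists_projectiveDimension_le [Finite G] (hG : IsUnit (Nat.card G : R))
    (M : ModuleCat.{max u v w} R) :
    ∃ N : ModuleCat.{max u v w} A.CrossedProduct,
      projectiveDimension M ≤ projectiveDimension N :=
  ⟨_, (A.retractCoextendScalars.{w} M).projectiveDimension_le.trans_eq
    (A.projectiveDimension_restrictScalars.{w} hG _)⟩

theorem leftGlobalDim_crossedProduct [Finite G] (hG : IsUnit (Nat.card G : R)) :
    leftGlobalDim.{max v w} R = leftGlobalDim.{w} A.CrossedProduct := by
  refine le_antisymm (iSup_le fun M => ?_) (iSup_le fun N => ?_)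
  · obtain ⟨N, hN⟩ := A.exists_projectiveDimension_le.{w} hG M
    exact hN.trans (le_iSup (fun N => projectiveDimension N) N)
  · rw [← A.projectiveDimension_restrictScalars.{w} hG]
    exact le_iSup (fun M : ModuleCat.{max u v w} R => projectiveDimension M) _

theorem isLeftHereditary_crossedProduct [Finite G] (hG : IsUnit (Nat.card G : R)) :
    IsLeftHereditary.{max v w} R ↔ IsLeftHereditary.{w} A.CrossedProduct := by
  refine ⟨fun h N => ?_, fun h M => ?_⟩
  · rw [← A.projectiveDimension_restrictScalars.{w} hG]
    exact h _
  · obtain ⟨N, hN⟩ := A.exists_projectiveDimension_le.{w} hG M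
    exact hN.trans (h N)

theorem isSemisimpleRing_crossedProduct [Finite G] (hG : IsUnit (Nat.card G : R)) :
    IsSemisimpleRing R ↔ IsSemisimpleRing A.CrossedProduct := by
  refine ⟨fun h => isSemisimpleRing_of_projective_quotient fun I => ?_,
    fun h => isSemisimpleRing_of_projective_quotient fun I => ?_⟩
  · have h1 := Module.projective_of_isSemisimpleRing R
      ((ModuleCat.restrictScalars A.toCrossedProduct).obj (ModuleCat.of _ (A.CrossedProduct ⧸ I)))
    have h2 := (A.projective_restrictScalars_iff.{max u v} hG (ModuleCat.of _ _)).mpr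
      ((IsProjective.iff_projective _).mp h1)
    exact (IsProjective.iff_projective _).mpr h2
  -- The quotient is lifted to the universe of the crossed product, where its coextension lives;
  -- projectivity then descends to the retract `M`.
  · let M : ModuleCat.{max u v} R := ModuleCat.of R (ULift.{v} (R ⧸ I))
    have h1 := Module.projective_of_isSemisimpleRing A.CrossedProduct
      ((ModuleCat.coextendScalars A.toCrossedProduct).obj M)
    have h2 := (A.projective_restrictScalars_iff.{max u v} hG _).mp
      ((IsProjective.iff_projective _).mp h1)
    have h3 : Projective M := projective_iff_hasProjectiveDimensionLT_one.mpr
      ((A.retractCoextendScalars.{max u v} M).hasProjectiveDimensionLT 1)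
    have : Small.{max u v} R := small_max.{v} R
    have h4 : Module.Projective R (ULift.{v} (R ⧸ I)) := (IsProjective.iff_projective _).mpr h3
    exact Module.Projective.of_ulift.{v} (M := R ⧸ I)

end UnitalTwistedPartialAction

theorem theorem55 (K : Type*) {R : Type u} {G : Type v} [CommRing K] [Ring R] [Algebra K R]
    [Group G] [Finite G] (A : UnitalTwistedPartialAction G R)
    (hG : IsUnit (Nat.card G : R)) :
    leftGlobalDim.{max v w} R = leftGlobalDim.{w} A.CrossedProduct ∧
      (IsLeftHereditary.{max v w} R ↔ IsLeftHereditary.{w} A.CrossedProduct) ∧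
      (IsSemisimpleRing R ↔ IsSemisimpleRing A.CrossedProduct) :=
  ⟨A.leftGlobalDim_crossedProduct hG, A.isLeftHereditary_crossedProduct hG,
    A.isSemisimpleRing_crossedProduct hG⟩
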